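/- **Theorem 1.3.** Let $\mathcal A$ be a finite set, let $f_j(x)=r_jx+b_j$, $j\in\mathcal A$, with $0<r_j<1$ and $b_j\in\mathbb R$, and let $F\subset\mathbb R$ be the associated self-similar set, that is, the nonempty compact set with $F=\bigcup_{j\in\mathcal A}f_j(F)$. Assume that $F$ is not a singleton and that $\log r_i/\log r_j$ is diophantine for some $i\neq j$ in $\mathcal A$, where an irrational number $a\in\mathbb R$ is called diophantine if there are $c>0$ and $l>2$ with $|a-p/q|\ge c/q^{l}$ for all $p\in\mathbb Z$ and all integers $q\ge 1$. Let $\mu$ be a self-similar measure on $F$, that is, a Borel probability measure on $\mathbb R$ with $\mu=\sum_{j\in\mathcal A}p_j\,f_j\mu$ for some weights $0<p_j<1$ with $\sum_{j\in\mathcal A}p_j=1$, where $f_j\mu$ is the push-forward of $\mu$ under $f_j$ (such a measure is automatically supported on $F$). Then there exists $\beta>0$ such that the Fourier transform $\widehat\mu(\xi)=\int e^{-2\pi i\xi x}\,d\mu(x)$ satisfies $$|\widehat\mu(\xi)|=O\Big(\frac{1}{|\log|\xi||^{\beta}}\Big),\qquad |\xi|\to\infty .$$ -/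

import Mathlib

open MeasureTheory

namespace SelfSimilar

/-- The affine map `f_j(x) = r_j x + b_j` of the real line. -/
def simMap {ι : Type*} (r b : ι → ℝ) (j : ι) (x : ℝ) : ℝ := r j * x + b j

/-- `F` is the self-similar set of the maps `f_j(x) = r_j x + b_j`:
a nonempty compact set with `F = ⋃ j, f_j(F)`. -/
def IsSelfSimilarSet {ι : Type*} (r b : ι → ℝ) (F : Set ℝ) : Prop :=
  F.Nonempty ∧ IsCompact F ∧ F = ⋃ j, simMap r b j '' F

/-- `μ` is a self-similar measure of the maps `f_j(x) = r_j x + b_j`: a Borel probability measure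
with `μ = ∑ j, p_j f_j μ` for some weights `0 < p_j < 1` with `∑ j, p_j = 1`,
where `f_j μ` is the push-forward. -/
def IsSelfSimilarMeasure {ι : Type*} [Fintype ι] (r b : ι → ℝ) (μ : Measure ℝ) : Prop :=
  IsProbabilityMeasure μ ∧
    ∃ p : ι → ℝ, (∀ j, 0 < p j ∧ p j < 1) ∧ ∑ j, p j = 1 ∧
      μ = ∑ j, ENNReal.ofReal (p j) • μ.map (simMap r b j)

/-- An irrational real number `a` is diophantine if, for some `c > 0` and `l > 2`,
`|a - p/q| ≥ c / q^l` for all integers `p` and positive integers `q`. -/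
def IsDiophantine (a : ℝ) : Prop :=
  Irrational a ∧
    ∃ c : ℝ, 0 < c ∧ ∃ l : ℝ, 2 < l ∧
      ∀ (p : ℤ) (q : ℕ), 0 < q → c / (q : ℝ) ^ l ≤ |a - (p : ℝ) / (q : ℝ)|

/-- The Fourier transform `ξ ↦ ∫ exp(-2πiξx) dμ(x)` of a measure on the real line. -/
noncomputable def fourierTransform (μ : Measure ℝ) (ξ : ℝ) : ℂ :=
  ∫ x : ℝ, Complex.exp (-2 * Real.pi * Complex.I * ξ * x) ∂μ

end SelfSimilar

/-! In the logarithmic variable, `u(s) = |μ̂(e^s)|²` satisfies `u(s) ≤ ∑ p_k u(s - l_k)` with `l_k =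
-log r_k`, so `u` is subharmonic for the random walk that descends by `l_k` with probability `p_k`.
Since `μ` is Hölder regular (`exists_holder`), averages of `u` over an interval of length `l_j` just
below height `A` are `O(e^{-γA})` (`exists_average_decay`). The walk turns this average decay into
pointwise decay at much greater heights.

Let `f(s)` be the expected sum of `u` over the visits of the walk from `s` to a window just below
`A`. Then `u ≤ f` above the window (`le_renewal`), `f` is bounded because the steps are bounded
below (`renewal_le`), and `f` is harmonic above `A`. A variance argument (`sq_add_sq_sub_shift_le`)
shows that `n` steps of room force `f(s) - f(s - l_i) = O(n^{-1/2})`. Hence `f` almost equals its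
average over translates by combinations `a l_i - m l_j`, which is controlled by the same averages of
`u` near `A` (`subharmonic_le`).

For a Dirichlet approximation `P/q` of `l_i/l_j` with `q ≤ Q`, the combinations with `a < q` and `m
= ⌊aP/q⌋` shadow the multiples of `l_j/q` in `[0, l_j)`. The averages of `u` are then Riemann sums,
with error `O(e^A/q)` by the Lipschitz bound on `μ̂`. The diophantine condition makes `q` at least a
constant times a power of `Q`. Altogether `u(s) = O(e^{-γA} + e^A/q + Q/√n)` once `s ≥ A + B(Q +
n)`, and optimising gives a negative power of `s = log|ξ|`. -/

open MeasureTheory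

namespace SelfSimilar

/-! ### Renewal series, and near-invariance of bounded harmonic functions of the walk. -/

/-- The truncated renewal series `∑_{m < n} 𝔼 h(s - S_m)` of the random walk `S` with steps `l k`
taken with probability `p k`. -/
noncomputable def renewal {ι : Type*} [Fintype ι] (p l : ι → ℝ) (h : ℝ → ℝ) : ℕ → ℝ → ℝ
  | 0, _ => 0
  | n + 1, s => h s + ∑ k, p k * renewal p l h n (s - l k)

section Renewal

variable {ι : Type*} [Fintype ι] {p l : ι → ℝ}

lemma renewal_nonneg (hp : ∀ k, 0 ≤ p k) {h : ℝ → ℝ} (hh : ∀ s, 0 ≤ h s) (n : ℕ) (s : ℝ) :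
    0 ≤ renewal p l h n s := by
  induction n generalizing s with
  | zero => simp [renewal]
  | succ n ih =>
    exact add_nonneg (hh s) (Finset.sum_nonneg fun k _ => mul_nonneg (hp k) (ih _))

/-- After `n` steps the walk from `s` is below `a`, where `h` vanishes, so the new term is zero.
Thus the truncated series solves the renewal equation exactly in this range. -/
lemma renewal_succ_eq {lo a : ℝ} (hlo : ∀ k, lo ≤ l k) {h : ℝ → ℝ} (hh : ∀ s < a, h s = 0)
    (n : ℕ) (s : ℝ) (hs : s < a + n * lo) : renewal p l h (n + 1) s = renewal p l h n s := by
  induction n generalizing s with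
  | zero => simp [renewal, hh s (by simpa using hs)]
  | succ n ih =>
    rw [renewal, renewal]
    congr 1
    refine Finset.sum_congr rfl fun k _ => ?_
    rw [ih]
    have := hlo k
    push_cast at hs
    linarith

/-- Each step descends by at least `lo`, so a path visits a window of length `W` at most `W / lo +
1` times. The induction bounds the visits still possible from `s`, which is why a minimum appears.
-/
lemma renewal_le (hp : ∀ k, 0 ≤ p k) (hp1 : ∑ k, p k = 1) {lo a W η : ℝ} (hlo0 : 0 < lo)
    (hlo : ∀ k, lo ≤ l k) (hη : 0 ≤ η) (hW : 0 ≤ W) {h : ℝ → ℝ}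
    (hin : ∀ s, a ≤ s → s < a + W → h s ≤ η)
    (hout : ∀ s, s < a ∨ a + W ≤ s → h s ≤ 0) (n : ℕ) (s : ℝ) :
    renewal p l h n s ≤ η * (W / lo + 1) := by
  have key : ∀ (n : ℕ) (s : ℝ), renewal p l h n s ≤
      η * min (W / lo + 1) (max 0 ((s - a) / lo + 1)) := by
    intro n
    induction n with
    | zero => intro s; simp only [renewal]; positivity
    | succ n ih =>
      intro s
      have h1 : ∑ k, p k * renewal p l h n (s - l k) ≤
          η * min (W / lo + 1) (max 0 ((s - a) / lo)) := by
        calc ∑ k, p k * renewal p l h n (s - l k)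
            ≤ ∑ k, p k * (η * min (W / lo + 1) (max 0 ((s - a) / lo))) := by
              refine Finset.sum_le_sum fun k _ => mul_le_mul_of_nonneg_left ((ih _).trans ?_) (hp k)
              have : (s - l k - a) / lo + 1 ≤ (s - a) / lo := by
                rw [div_add_one hlo0.ne']
                have := hlo k
                gcongr
                linarith
              gcongr
          _ = _ := by rw [← Finset.sum_mul, hp1, one_mul]
      rw [renewal]
      rcases lt_or_ge s a with hs | hs
      · have h2 := hout s (Or.inl hs)
        have h3 : max 0 ((s - a) / lo) ≤ max 0 ((s - a) / lo + 1) := by gcongr; linarith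
        have h4 : η * min (W / lo + 1) (max 0 ((s - a) / lo)) ≤
          η * min (W / lo + 1) (max 0 ((s - a) / lo + 1)) := by gcongr
        linarith
      have h0 : 0 ≤ (s - a) / lo := div_nonneg (by linarith) hlo0.le
      rw [max_eq_right h0] at h1
      rw [max_eq_right (by linarith)]
      rcases lt_or_ge s (a + W) with hs' | hs'
      · have h2 := hin s hs hs'
        have h3 : (s - a) / lo ≤ W / lo := by gcongr; linarith
        rw [min_eq_right (by linarith)] at h1 ⊢
        linarith
      · have h2 := hout s (Or.inr hs')
        have h3 : W / lo ≤ (s - a) / lo := by gcongr; linarith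
        have h4 : η * min (W / lo + 1) ((s - a) / lo) ≤ η * min (W / lo + 1) ((s - a) / lo + 1) := by
          gcongr; linarith
        linarith
  exact (key n s).trans (mul_le_mul_of_nonneg_left (min_le_left _ _) hη)

/-- Optional stopping at the first entry into `[A - hi, A)`. No step exceeds `hi`, so the window
cannot be jumped over, and the upper bound on `s` ensures entry before the series is cut off. -/
lemma le_renewal (hp : ∀ k, 0 ≤ p k) {lo hi A : ℝ} (hlo : ∀ k, lo ≤ l k) (hhi : ∀ k, l k ≤ hi)
    {u h : ℝ → ℝ} (hh : ∀ s, 0 ≤ h s) (huh : ∀ s, A - hi ≤ s → s < A → u s ≤ h s)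
    (hsub : ∀ s, u s ≤ ∑ k, p k * u (s - l k)) (n : ℕ) (s : ℝ) (hs : A - hi ≤ s)
    (hs' : s < A - hi + n * lo) : u s ≤ renewal p l h n s := by
  induction n generalizing s with
  | zero => simp at hs'; linarith
  | succ n ih =>
    push_cast at hs'
    rw [renewal]
    rcases lt_or_ge s A with h1 | h1
    · exact (huh s hs h1).trans (le_add_of_nonneg_right
        (Finset.sum_nonneg fun k _ => mul_nonneg (hp k) (renewal_nonneg hp hh _ _)))
    · refine (hsub s).trans ((Finset.sum_le_sum fun k _ => mul_le_mul_of_nonneg_left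
        (ih _ ?_ ?_) (hp k)).trans (le_add_of_nonneg_left (hh s)))
      · linarith [hhi k]
      · linarith [hlo k]

lemma sum_renewal_sub {β : Type*} (t : Finset β) (x : β → ℝ) (h : ℝ → ℝ) (n : ℕ) (s : ℝ) :
    ∑ b ∈ t, renewal p l h n (s - x b) = renewal p l (fun y => ∑ b ∈ t, h (y - x b)) n s := by
  induction n generalizing s with
  | zero => simp [renewal]
  | succ n ih =>
    simp only [renewal, Finset.sum_add_distrib]
    congr 1
    rw [Finset.sum_comm]
    refine Finset.sum_congr rfl fun k _ => ?_
    rw [← Finset.mul_sum, ← ih]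
    congr 1
    exact Finset.sum_congr rfl fun b _ => by rw [sub_right_comm]

/-- A bounded function that is harmonic for the walk is almost invariant under its steps. -/
lemma sq_add_sq_sub_shift_le (hp : ∀ k, 0 ≤ p k) (hp1 : ∑ k, p k = 1) {hi A B M : ℝ}
    (hpos : ∀ k, 0 ≤ l k) (hhi : ∀ k, l k ≤ hi) {f : ℝ → ℝ} (hM : ∀ s, |f s| ≤ M)
    (hf : ∀ s, A ≤ s → s < B → f s = ∑ k, p k * f (s - l k)) (i : ι) (n : ℕ) (s : ℝ)
    (hs : A + (n + 1) * hi ≤ s) (hsB : s < B) :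
    f s ^ 2 + n * p i * (f s - f (s - l i)) ^ 2 ≤ M ^ 2 := by
  induction n generalizing s with
  | zero => simpa using sq_le_sq' (abs_le.1 (hM s)).1 (abs_le.1 (hM s)).2
  | succ n ih =>
    push_cast at hs ⊢
    have hi0 : 0 ≤ hi := (hpos i).trans (hhi i)
    have hA : A + l i ≤ s := by nlinarith [hhi i, (Nat.cast_nonneg n : (0 : ℝ) ≤ n)]
    have hfs := hf s (by linarith [hpos i]) hsB
    have hfi := hf (s - l i) (by linarith) (by linarith [hpos i])
    set D : ℝ → ℝ := fun y => f y - f (y - l i) with hD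
    -- The increment `D` is itself harmonic; this needs harmonicity of `f` at both `s` and `s - l
    -- i`.
    have hDs : D s = ∑ k, p k * D (s - l k) := by
      simp only [hD, mul_sub, Finset.sum_sub_distrib]
      rw [← hfs, hfi]
      simp only [sub_right_comm]
    have jensen : D s ^ 2 ≤ ∑ k, p k * D (s - l k) ^ 2 := by
      have h0 : 0 ≤ ∑ k, p k * (D (s - l k) - D s) ^ 2 :=
        Finset.sum_nonneg fun k _ => mul_nonneg (hp k) (sq_nonneg _)
      have h1 : ∑ k, p k * (D (s - l k) - D s) ^ 2 =
          ∑ k, p k * D (s - l k) ^ 2 - 2 * D s * ∑ k, p k * D (s - l k)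
            + D s ^ 2 * ∑ k, p k := by
        rw [Finset.mul_sum, Finset.mul_sum, ← Finset.sum_sub_distrib, ← Finset.sum_add_distrib]
        exact Finset.sum_congr rfl fun k _ => by ring
      rw [← hDs, hp1] at h1
      nlinarith
    -- One step raises the mean of `f ^ 2` by the variance of `f`, of which only the term `k = i` is
    -- kept. By `jensen` the mean of `D ^ 2` does not decrease down the walk, so each of the `n`
    -- steps gains at least `p i * D s ^ 2`, while the total stays below `M ^ 2`.
    have var : f s ^ 2 + p i * D s ^ 2 ≤ ∑ k, p k * f (s - l k) ^ 2 := by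
      have h0 : p i * (f s - f (s - l i)) ^ 2 ≤ ∑ k, p k * (f s - f (s - l k)) ^ 2 :=
        Finset.single_le_sum (f := fun k => p k * (f s - f (s - l k)) ^ 2)
          (fun k _ => mul_nonneg (hp k) (sq_nonneg _)) (Finset.mem_univ i)
      have h1 : ∑ k, p k * (f s - f (s - l k)) ^ 2 =
          ∑ k, p k * f (s - l k) ^ 2 - 2 * f s * ∑ k, p k * f (s - l k)
            + f s ^ 2 * ∑ k, p k := by
        rw [Finset.mul_sum, Finset.mul_sum, ← Finset.sum_sub_distrib, ← Finset.sum_add_distrib]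
        exact Finset.sum_congr rfl fun k _ => by ring
      rw [← hfs, hp1] at h1
      simp only [hD]
      nlinarith
    have hstep : ∑ k, p k * (f (s - l k) ^ 2 + n * p i * D (s - l k) ^ 2) ≤ M ^ 2 := by
      calc _ ≤ ∑ k, p k * M ^ 2 := by
            refine Finset.sum_le_sum fun k _ => mul_le_mul_of_nonneg_left (ih _ ?_ ?_) (hp k)
            · linarith [hhi k]
            · linarith [hpos k]
        _ = M ^ 2 := by rw [← Finset.sum_mul, hp1, one_mul]
    have hsplit : ∑ k, p k * (f (s - l k) ^ 2 + n * p i * D (s - l k) ^ 2) =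
        ∑ k, p k * f (s - l k) ^ 2 + n * p i * ∑ k, p k * D (s - l k) ^ 2 := by
      rw [Finset.mul_sum, ← Finset.sum_add_distrib]
      exact Finset.sum_congr rfl fun k _ => by ring
    have : n * p i * D s ^ 2 ≤ n * p i * ∑ k, p k * D (s - l k) ^ 2 :=
      mul_le_mul_of_nonneg_left jensen (mul_nonneg (Nat.cast_nonneg n) (hp i))
    change f s ^ 2 + (n + 1) * p i * D s ^ 2 ≤ M ^ 2
    linarith

lemma abs_sub_shift_le (hp : ∀ k, 0 < p k) (hp1 : ∑ k, p k = 1) {hi A B M : ℝ}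
    (hpos : ∀ k, 0 ≤ l k) (hhi : ∀ k, l k ≤ hi) {f : ℝ → ℝ} (hM : ∀ s, |f s| ≤ M)
    (hf : ∀ s, A ≤ s → s < B → f s = ∑ k, p k * f (s - l k)) (i : ι) {n : ℕ} (hn : 0 < n) (m : ℕ)
    (s : ℝ) (hs : A + (n + 1) * hi ≤ s - m * l i) (hsB : s < B) :
    |f s - f (s - m * l i)| ≤ m * (M / √(n * p i)) := by
  induction m with
  | zero => simp
  | succ m ih =>
    push_cast at hs ⊢
    have h1 := ih (by linarith [hpos i])
    have hml : 0 ≤ m * l i := mul_nonneg (Nat.cast_nonneg m) (hpos i)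
    have hM0 : 0 ≤ M := (abs_nonneg _).trans (hM 0)
    have h2 := sq_add_sq_sub_shift_le (fun k => (hp k).le) hp1 hpos hhi hM hf i n (s - m * l i)
      (by linarith [hpos i]) (by linarith)
    have hnp : 0 < n * p i := mul_pos (by exact_mod_cast hn) (hp i)
    have h3 : |f (s - m * l i) - f (s - m * l i - l i)| ≤ M / √(n * p i) := by
      rw [le_div_iff₀ (Real.sqrt_pos.2 hnp)]
      refine abs_le_of_sq_le_sq' ?_ hM0 |>.2
      rw [mul_pow, sq_abs, Real.sq_sqrt hnp.le]
      nlinarith [sq_nonneg (f (s - m * l i))]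
    have h4 : s - (m + 1) * l i = s - m * l i - l i := by ring
    rw [h4]
    calc _ ≤ |f s - f (s - m * l i)| + |f (s - m * l i) - f (s - m * l i - l i)| :=
          abs_sub_le _ _ _
      _ ≤ _ := by linarith

/-- A bounded subharmonic function of the walk is controlled by its averages, at a much lower
height, over any set of integer combinations of two of the steps. -/
theorem subharmonic_le (hp : ∀ k, 0 < p k) (hp1 : ∑ k, p k = 1) {lo hi : ℝ} (hlo0 : 0 < lo)
    (hlo : ∀ k, lo ≤ l k) (hhi : ∀ k, l k ≤ hi) {u : ℝ → ℝ} (hu0 : ∀ s, 0 ≤ u s)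
    (hu1 : ∀ s, u s ≤ 1) (hsub : ∀ s, u s ≤ ∑ k, p k * u (s - l k)) (i j : ι) {A s η w T : ℝ}
    {n : ℕ} (hn : 0 < n) {β : Type*} {t : Finset β} (ht : t.Nonempty) {x : β → ℝ} {a m : β → ℕ}
    (hx : ∀ b ∈ t, x b = a b * l i - m b * l j) (hT : ∀ b ∈ t, (a b + m b : ℝ) ≤ T)
    (hw : ∀ b ∈ t, |x b| ≤ w) (hη0 : 0 ≤ η)
    (hη : ∀ y, A - hi - w ≤ y → y < A + w → ∑ b ∈ t, u (y - x b) ≤ t.card * η)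
    {c : ℝ} (hc0 : 0 < c) (hc : ∀ k, c ≤ p k) (hs : A + T * hi + (n + 1) * hi ≤ s) :
    u s ≤ η * ((hi + 2 * w) / lo + 1) + T * ((hi / lo + 1) / √(n * c)) := by
  obtain ⟨b₀, hb₀⟩ := ht
  have hw0 : 0 ≤ w := (abs_nonneg _).trans (hw b₀ hb₀)
  have hhi0 : 0 < hi := hlo0.trans_le ((hlo i).trans (hhi i))
  have hT0 : 0 ≤ T := le_trans (by positivity) (hT b₀ hb₀)
  have hp' : ∀ k, 0 ≤ p k := fun k => (hp k).le
  have hpos : ∀ k, 0 ≤ l k := fun k => hlo0.le.trans (hlo k)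
  -- `N` is large enough that `s` and every `s - x b` lie below `B`, where truncation does not
  -- affect harmonicity.
  obtain ⟨N, hN⟩ := exists_nat_gt ((s + w + hi - A) / lo)
  rw [div_lt_iff₀ hlo0] at hN
  set h : ℝ → ℝ := (Set.Ico (A - hi) A).indicator u with hh
  have hh0 : ∀ y, 0 ≤ h y := fun y => Set.indicator_nonneg (fun z _ => hu0 z) y
  have hhu : ∀ y, h y ≤ u y := fun y => Set.indicator_le_self' (fun z _ => hu0 z) y
  have hhout : ∀ y, y ∉ Set.Ico (A - hi) A → h y = 0 := fun y hy => Set.indicator_of_notMem hy _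
  set f := renewal p l h N with hf
  have hfM : ∀ y, |f y| ≤ hi / lo + 1 := by
    intro y
    rw [abs_of_nonneg (renewal_nonneg hp' hh0 _ _)]
    have := renewal_le hp' hp1 (a := A - hi) (W := hi) (η := 1) hlo0 hlo zero_le_one hhi0.le (h := h)
      (fun z _ _ => (hhu z).trans (hu1 z))
      (fun z hz => (hhout z (fun hz' => by
        rcases hz with hz | hz
        · exact absurd hz'.1 (not_le.2 hz)
        · have := hz'.2; linarith)).le) N y
    linarith
  set B := A - hi + N * lo with hB
  have hharm : ∀ y, A ≤ y → y < B → f y = ∑ k, p k * f (y - l k) := by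
    intro y hy hy'
    have h1 := renewal_succ_eq (p := p) (l := l) (a := A - hi) hlo (h := h)
      (fun z hz => hhout z (fun hz' => absurd hz'.1 (not_le.2 hz))) N y hy'
    rw [hf, ← h1, renewal, hhout y (fun hz' => absurd hz'.2 (not_lt.2 hy)), zero_add]
  set M := hi / lo + 1 with hMdef
  have hM0 : 0 ≤ M := by positivity
  have hn0 : (0 : ℝ) < n := by exact_mod_cast hn
  have hsq : ∀ k, M / √(n * p k) ≤ M / √(n * c) := fun k => by
    have := hc k
    gcongr
  -- Descending `a b` times by `l i` from `s`, or `m b` times by `l j` from `s - x b`, leads to the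
  -- same point; `f` hardly changes along either path.
  have hnear : ∀ b ∈ t, f s ≤ f (s - x b) + T * (M / √(n * c)) := by
    intro b hb
    have hab := hT b hb
    have hxb := hx b hb
    have hwb := abs_le.1 (hw b hb)
    have ha0 : (0 : ℝ) ≤ a b := Nat.cast_nonneg _
    have hm0 : (0 : ℝ) ≤ m b := Nat.cast_nonneg _
    have haT : a b * l i ≤ T * hi :=
      mul_le_mul (by linarith) (hhi i) (hpos i) hT0
    have hml : 0 ≤ m b * l j := mul_nonneg hm0 (hpos j)
    have e : s - x b - m b * l j = s - a b * l i := by rw [hxb]; ring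
    have h1 := abs_sub_shift_le hp hp1 hpos hhi hfM hharm i hn (a b) s (by linarith) (by linarith)
    have h2 := abs_sub_shift_le hp hp1 hpos hhi hfM hharm j hn (m b) (s - x b)
      (by rw [e]; linarith) (by linarith)
    rw [e] at h2
    have h3 := mul_le_mul_of_nonneg_left (hsq i) ha0
    have h4 := mul_le_mul_of_nonneg_left (hsq j) hm0
    have h5 : (a b + m b) * (M / √(n * c)) ≤ T * (M / √(n * c)) :=
      mul_le_mul_of_nonneg_right hab (by positivity)
    have h6 := (abs_le.1 h1).2
    have h7 := (abs_le.1 h2).1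
    linarith
  have hcard : (0 : ℝ) < t.card := by exact_mod_cast Finset.card_pos.2 ⟨b₀, hb₀⟩
  have hus : u s ≤ f s := by
    have hAs : A ≤ s := by nlinarith
    refine le_renewal (A := A) (u := u) (h := h) hp' hlo hhi hh0 (fun y hy hy' => ?_) hsub N s
      (by linarith) (by linarith)
    exact (Set.indicator_of_mem (s := Set.Ico (A - hi) A) ⟨hy, hy'⟩ u).ge
  -- The averaged source lives on the window widened by `w` on both sides, where `hη` bounds it, so
  -- the visit count applies to the average instead of to `h`.
  have hsum : ∑ b ∈ t, f (s - x b) ≤ t.card * η * ((hi + 2 * w) / lo + 1) := by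
    rw [hf, sum_renewal_sub]
    refine renewal_le hp' hp1 (a := A - hi - w) hlo0 hlo (by positivity) (by positivity)
      (fun y hy hy' => ?_) (fun y hy => (Finset.sum_eq_zero fun b hb => ?_).le) N s
    · exact (Finset.sum_le_sum fun b _ => hhu _).trans (hη y hy (by linarith))
    · have hwb := abs_le.1 (hw b hb)
      refine hhout _ fun hz => ?_
      rcases hy with hy | hy
      · have := hz.1; linarith
      · have := hz.2; linarith
  have hfinal : t.card * f s ≤ t.card * η * ((hi + 2 * w) / lo + 1)
      + t.card * (T * (M / √(n * c))) := by
    calc t.card * f s = ∑ b ∈ t, f s := by rw [Finset.sum_const, nsmul_eq_mul]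
      _ ≤ ∑ b ∈ t, (f (s - x b) + T * (M / √(n * c))) := Finset.sum_le_sum hnear
      _ = ∑ b ∈ t, f (s - x b) + t.card * (T * (M / √(n * c))) := by
          rw [Finset.sum_add_distrib, Finset.sum_const, nsmul_eq_mul]
      _ ≤ _ := by linarith
  refine hus.trans (le_of_mul_le_mul_left ?_ hcard)
  linarith

end Renewal

/-! ### Diophantine approximation and Riemann sums over permuted cells. -/

section Approximation

/-- Dirichlet approximation of a positive diophantine number produces large denominators. -/
lemma IsDiophantine.exists_approx {α : ℝ} (h : IsDiophantine α) (hα : 0 < α) :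
    ∃ c : ℝ, 0 < c ∧ ∃ e : ℝ, 1 < e ∧ ∀ Q : ℕ, 0 < Q → ∃ q P : ℕ, 0 < q ∧ q ≤ Q ∧
      Nat.Coprime P q ∧ |α - P / q| ≤ 1 / (Q * q) ∧ c * Q ≤ (q : ℝ) ^ e := by
  obtain ⟨-, c, hc, l, hl, H⟩ := h
  refine ⟨c, hc, l - 1, by linarith, fun Q hQ => ?_⟩
  obtain ⟨x, hx, hxQ⟩ := Real.exists_rat_abs_sub_le_and_den_le α hQ
  have hq : 0 < x.den := x.den_pos
  have hqR : (0 : ℝ) < x.den := by exact_mod_cast hq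
  have hQR : (0 : ℝ) < Q := by exact_mod_cast hQ
  have hx1 : |α - x| ≤ 1 / (Q * x.den) := hx.trans (by gcongr; linarith)
  have hxe : (x : ℝ) = x.num / x.den := Rat.cast_def x
  have hnum : 0 ≤ x.num := by
    by_contra hneg
    have h1 : (x.num : ℝ) ≤ -1 := by exact_mod_cast (by omega : x.num ≤ -1)
    have h2 : (x : ℝ) ≤ -1 / x.den := by rw [hxe]; gcongr
    have h3 : 1 / (((Q : ℝ) + 1) * x.den) ≤ 1 / x.den := by
      gcongr; nlinarith
    have h4 := (abs_le.1 hx).2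
    rw [neg_div] at h2
    linarith
  have hcast : (x.num : ℝ) = (x.num.natAbs : ℝ) := by
    rw [← Int.cast_natCast, Int.natCast_natAbs, abs_of_nonneg hnum]
  refine ⟨x.den, x.num.natAbs, hq, hxQ, x.reduced, by rwa [← hcast, ← hxe], ?_⟩
  -- The diophantine lower bound `c / q ^ l` against Dirichlet's upper bound `1 / (Q q)` gives `c Q
  -- ≤ q ^ (l - 1)`.
  have h1 := H x.num x.den hq
  rw [← hxe] at h1
  replace h1 := h1.trans hx1
  rw [div_le_div_iff₀ (by positivity) (by positivity), one_mul] at h1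
  rw [Real.rpow_sub_one hqR.ne', le_div_iff₀ hqR]
  linarith

lemma sum_mul_mod_eq {M : Type*} [AddCommMonoid M] {q P : ℕ} (hq : 0 < q) (hP : Nat.Coprime P q)
    (G : ℕ → M) : ∑ a ∈ Finset.range q, G (a * P % q) = ∑ b ∈ Finset.range q, G b := by
  have hinj : Set.InjOn (fun a => a * P % q) (Finset.range q : Set ℕ) := by
    intro a ha a' ha' h
    have h1 : a * P ≡ a' * P [MOD q] := h
    have h2 := Nat.ModEq.cancel_right_of_coprime (by rwa [Nat.coprime_comm] at hP) h1
    exact Nat.ModEq.eq_of_lt_of_lt h2 (by simpa using ha) (by simpa using ha')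
  have himg : (Finset.range q).image (fun a => a * P % q) = Finset.range q := by
    refine Finset.eq_of_subset_of_card_le (fun b hb => ?_) ?_
    · obtain ⟨a, -, rfl⟩ := Finset.mem_image.1 hb
      exact Finset.mem_range.2 (Nat.mod_lt _ hq)
    · rw [Finset.card_image_of_injOn hinj]
  conv_rhs => rw [← himg, Finset.sum_image hinj]

/-- Since `P` is invertible modulo `q`, the cells of length `1 / q` indexed by `a * P % q` tile `[0,
1]` exactly once; each `v' a` is compared with the mean of `v` on its cell. -/
lemma sum_le_mul_integral {q P : ℕ} (hq : 0 < q) (hP : Nat.Coprime P q) {v : ℝ → ℝ}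
    (hv : Continuous v) {v' : ℕ → ℝ} {K : ℝ}
    (h : ∀ a < q, ∀ z : ℝ, ((a * P % q : ℕ) : ℝ) / q ≤ z → z ≤ (((a * P % q : ℕ) : ℝ) + 1) / q →
      v' a ≤ v z + K) :
    ∑ a ∈ Finset.range q, v' a ≤ q * ((∫ z in (0 : ℝ)..1, v z) + K) := by
  have hqR : (0 : ℝ) < q := by exact_mod_cast hq
  have hcell : ∀ a ∈ Finset.range q, v' a ≤
      q * (∫ z in ((a * P % q : ℕ) : ℝ) / q..((a * P % q + 1 : ℕ) : ℝ) / q, v z) + K := by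
    intro a ha
    have h1 : ((a * P % q : ℕ) : ℝ) / q ≤ ((a * P % q + 1 : ℕ) : ℝ) / q := by
      gcongr; linarith
    have h2 := intervalIntegral.integral_mono_on h1 (μ := volume) (f := fun _ => v' a - K) (g := v)
      intervalIntegrable_const (hv.intervalIntegrable _ _) (fun z hz => by
        have := h a (Finset.mem_range.1 ha) z hz.1 (by simpa using hz.2)
        linarith)
    rw [intervalIntegral.integral_const, smul_eq_mul, ← sub_div] at h2
    have h3 : ((a * P % q + 1 : ℕ) : ℝ) - ((a * P % q : ℕ) : ℝ) = 1 := by push_cast; ring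
    rw [h3] at h2
    have h4 := mul_le_mul_of_nonneg_left h2 hqR.le
    have h5 : (q : ℝ) * (1 / q * (v' a - K)) = v' a - K := by field_simp
    linarith
  refine (Finset.sum_le_sum hcell).trans ?_
  rw [Finset.sum_add_distrib, ← Finset.mul_sum, Finset.sum_const, nsmul_eq_mul, Finset.card_range,
    sum_mul_mod_eq hq hP (fun b => ∫ z in ((b : ℕ) : ℝ) / q..((b + 1 : ℕ) : ℝ) / q, v z),
    intervalIntegral.sum_integral_adjacent_intervals (fun b _ => hv.intervalIntegrable _ _)]
  rw [Nat.cast_zero, zero_div, div_self hqR.ne', mul_add]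

/-- The combinations `a l₁ - ⌊a P / q⌋ l₂` lie close to multiples of `l₂ / q` when `P / q` is a
Dirichlet approximation of `l₁ / l₂`. -/
lemma abs_combination_sub_le {q P Q a : ℕ} (hq : 0 < q) (hqQ : q ≤ Q) (ha : a < q) {l₁ l₂ : ℝ}
    (hl₂ : 0 < l₂) (happ : |l₁ / l₂ - P / q| ≤ 1 / (Q * q)) :
    |a * l₁ - (a * P / q : ℕ) * l₂ - l₂ * (((a * P % q : ℕ) : ℝ) / q)| ≤ l₂ / q := by
  have hqR : (0 : ℝ) < q := by exact_mod_cast hq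
  have hQR : (q : ℝ) ≤ Q := by exact_mod_cast hqQ
  have hdiv : (a * P : ℝ) = q * (a * P / q : ℕ) + (a * P % q : ℕ) := by
    exact_mod_cast (Nat.div_add_mod (a * P) q).symm
  -- Writing `a P = q ⌊a P / q⌋ + (a P mod q)` reduces the deviation to `a` times the approximation
  -- error.
  have e : a * l₁ - (a * P / q : ℕ) * l₂ - l₂ * (((a * P % q : ℕ) : ℝ) / q)
      = l₂ * (a * (l₁ / l₂ - P / q)) := by
    have : (((a * P % q : ℕ) : ℝ)) = a * P - q * (a * P / q : ℕ) := by linarith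
    rw [this]
    field_simp
    ring
  rw [e, abs_mul, abs_mul, abs_of_pos hl₂, Nat.abs_cast, div_eq_mul_one_div l₂ (q : ℝ)]
  have haq : (a : ℝ) ≤ Q := (by exact_mod_cast ha.le : (a : ℝ) ≤ q).trans hQR
  have hQ0 : (0 : ℝ) < Q := hqR.trans_le hQR
  refine mul_le_mul_of_nonneg_left ?_ hl₂.le
  calc a * |l₁ / l₂ - P / q| ≤ Q * (1 / (Q * q)) := by gcongr
    _ = 1 / q := by field_simp

end Approximation

/-! ### Support and Hölder regularity of self-similar measures. -/

section Measure

universe v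

variable {ι : Type v} {r b : ι → ℝ} {F : Set ℝ} {μ : Measure ℝ}

lemma continuous_simMap (r b : ι → ℝ) (j : ι) : Continuous (simMap r b j) := by
  unfold simMap; fun_prop

lemma measure_eq_sum [Fintype ι] {p : ι → ℝ}
    (hμ : μ = ∑ j, ENNReal.ofReal (p j) • μ.map (simMap r b j)) {S : Set ℝ}
    (hS : MeasurableSet S) :
    μ S = ∑ j, ENNReal.ofReal (p j) * μ (simMap r b j ⁻¹' S) := by
  conv_lhs => rw [hμ]
  simp only [Measure.coe_finsetSum, Finset.sum_apply, Measure.smul_apply, smul_eq_mul]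
  exact Finset.sum_congr rfl fun j _ => by
    rw [Measure.map_apply (continuous_simMap r b j).measurable hS]

lemma real_eq_sum [Fintype ι] [IsProbabilityMeasure μ] {p : ι → ℝ} (hp : ∀ j, 0 ≤ p j)
    (hμ : μ = ∑ j, ENNReal.ofReal (p j) • μ.map (simMap r b j)) {S : Set ℝ}
    (hS : MeasurableSet S) : μ.real S = ∑ j, p j * μ.real (simMap r b j ⁻¹' S) := by
  rw [measureReal_def, measure_eq_sum hμ hS, ENNReal.toReal_sum
    (fun j _ => ENNReal.mul_ne_top ENNReal.ofReal_ne_top (measure_ne_top _ _))]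
  exact Finset.sum_congr rfl fun j _ => by
    rw [ENNReal.toReal_mul, ENNReal.toReal_ofReal (hp j), measureReal_def]

lemma infDist_simMap_le (hF : IsSelfSimilarSet r b F) {j : ι} (hr : 0 ≤ r j) (x : ℝ) :
    Metric.infDist (simMap r b j x) F ≤ r j * Metric.infDist x F := by
  obtain ⟨y, hy, hxy⟩ := hF.2.1.exists_infDist_eq_dist hF.1 x
  have hmem : simMap r b j y ∈ F := by
    rw [hF.2.2]
    exact Set.mem_iUnion.2 ⟨j, y, hy, rfl⟩
  refine (Metric.infDist_le_dist_of_mem hmem).trans ?_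
  rw [hxy, Real.dist_eq, Real.dist_eq, simMap, simMap, ← abs_of_nonneg hr, ← abs_mul,
    abs_of_nonneg hr]
  apply le_of_eq
  congr 1
  ring

lemma exists_ratio_bound [Finite ι] (hr : ∀ j, 0 < r j ∧ r j < 1) :
    ∃ ρ : ℝ, 0 < ρ ∧ ρ < 1 ∧ ∀ j, r j ≤ ρ := by
  rcases isEmpty_or_nonempty ι with h | h
  · exact ⟨1 / 2, by norm_num, by norm_num, fun j => (IsEmpty.false j).elim⟩
  · obtain ⟨j, hj⟩ := Finite.exists_max r
    exact ⟨r j, (hr j).1, (hr j).2, hj⟩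

/-- A self-similar measure is carried by the self-similar set. -/
lemma measure_compl_eq_zero [Fintype ι] (hr : ∀ j, 0 < r j ∧ r j < 1)
    (hF : IsSelfSimilarSet r b F) (hμ : IsSelfSimilarMeasure r b μ) : μ Fᶜ = 0 := by
  obtain ⟨hprob, p, hp, hp1, hμe⟩ := hμ
  obtain ⟨ρ, hρ0, hρ1, hρ⟩ := exists_ratio_bound hr
  set S : ℝ → Set ℝ := fun t => {x | t < Metric.infDist x F} with hS
  have hSm : ∀ t, MeasurableSet (S t) := fun t =>
    measurableSet_lt measurable_const (Metric.continuous_infDist_pt F).measurable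
  -- Each map contracts the distance to `F`, so a point sent into `S t` was already in `S (t / ρ)`.
  -- Iterating pushes the mass off `F` to infinity, where a finite measure has none.
  have step : ∀ t, μ (S t) ≤ μ (S (t / ρ)) := by
    intro t
    rw [measure_eq_sum hμe (hSm t)]
    calc ∑ j, ENNReal.ofReal (p j) * μ (simMap r b j ⁻¹' S t)
        ≤ ∑ j, ENNReal.ofReal (p j) * μ (S (t / ρ)) := by
          refine Finset.sum_le_sum fun j _ => mul_le_mul_right (measure_mono fun x hx => ?_) _
          have h1 : t < Metric.infDist (simMap r b j x) F := hx
          have h2 := infDist_simMap_le hF (hr j).1.le x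
          have h3 := mul_le_mul_of_nonneg_right (hρ j) (Metric.infDist_nonneg (x := x) (s := F))
          change t / ρ < _
          rw [div_lt_iff₀ hρ0]
          linarith
      _ = μ (S (t / ρ)) := by
          rw [← Finset.sum_mul, ← ENNReal.ofReal_sum_of_nonneg (fun j _ => (hp j).1.le), hp1]
          simp
  have iter : ∀ t (n : ℕ), μ (S t) ≤ μ (S (t * (1 / ρ) ^ n)) := by
    intro t n
    induction n with
    | zero => simp
    | succ n ih =>
      refine ih.trans ((step _).trans (le_of_eq ?_))
      congr 2
      rw [pow_succ]
      ring
  have hone : 1 < 1 / ρ := by rw [lt_div_iff₀ hρ0]; linarith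
  have hzero : ∀ t, 0 < t → μ (S t) = 0 := by
    intro t ht
    have hanti : Antitone fun n : ℕ => S (t * (1 / ρ) ^ n) := by
      intro n m hnm x hx
      refine lt_of_le_of_lt ?_ (show _ < Metric.infDist x F from hx)
      gcongr
      exact hone.le
    have hlim := tendsto_measure_iInter_atTop (μ := μ)
      (fun n => (hSm (t * (1 / ρ) ^ n)).nullMeasurableSet) hanti ⟨0, measure_ne_top _ _⟩
    have hempty : ⋂ n : ℕ, S (t * (1 / ρ) ^ n) = ∅ := by
      refine Set.eq_empty_of_forall_notMem fun x hx => ?_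
      obtain ⟨n, hn⟩ := pow_unbounded_of_one_lt (Metric.infDist x F / t) hone
      rw [div_lt_iff₀ ht] at hn
      have : t * (1 / ρ) ^ n < Metric.infDist x F := Set.mem_iInter.1 hx n
      linarith
    rw [hempty, measure_empty] at hlim
    exact le_antisymm (ge_of_tendsto' hlim (iter t)) zero_le
  have hcover : Fᶜ ⊆ ⋃ n : ℕ, S (1 / ((n : ℝ) + 1)) := by
    intro x hx
    have hpos : 0 < Metric.infDist x F :=
      (hF.2.1.isClosed.notMem_iff_infDist_pos hF.1).1 hx
    obtain ⟨n, hn⟩ := exists_nat_one_div_lt hpos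
    exact Set.mem_iUnion.2 ⟨n, hn⟩
  exact measure_mono_null hcover (measure_iUnion_null fun n => hzero _ (by positivity))

/-- Iterated function systems consisting of arbitrarily strong contractions. -/
lemma exists_iterated_system [Fintype ι] (hF : F = ⋃ j, simMap r b j '' F) {p : ι → ℝ}
    (hp : ∀ j, 0 < p j) (hp1 : ∑ j, p j = 1) {ρ : ℝ} (hr : ∀ j, 0 < r j ∧ r j ≤ ρ)
    (hμ : ∀ S, MeasurableSet S → μ.real S = ∑ j, p j * μ.real (simMap r b j ⁻¹' S)) (n : ℕ) :
    ∃ (κ : Type v) (_ : Fintype κ) (p' r' b' : κ → ℝ), (∀ k, 0 < p' k) ∧ ∑ k, p' k = 1 ∧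
      (∀ k, 0 < r' k ∧ r' k ≤ ρ ^ n) ∧
      (∀ S, MeasurableSet S → μ.real S = ∑ k, p' k * μ.real (simMap r' b' k ⁻¹' S)) ∧
      F ⊆ ⋃ k, simMap r' b' k '' F := by
  induction n with
  | zero =>
    refine ⟨PUnit, inferInstance, fun _ => 1, fun _ => 1, fun _ => 0, by simp, by simp, by simp,
      fun S _ => ?_, fun x hx => Set.mem_iUnion.2 ⟨PUnit.unit, x, hx, by simp [simMap]⟩⟩
    have : simMap (fun _ : PUnit.{v + 1} => (1 : ℝ)) (fun _ => 0) PUnit.unit = id := by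
      ext x; simp [simMap]
    simp [this]
  | succ n ih =>
    obtain ⟨κ, _, p', r', b', h1, h2, h3, h4, h5⟩ := ih
    have hcomp : ∀ k j, simMap (fun q : κ × ι => r' q.1 * r q.2)
        (fun q => r' q.1 * b q.2 + b' q.1) (k, j) = simMap r' b' k ∘ simMap r b j := by
      intro k j; ext x; simp only [simMap, Function.comp]; ring
    refine ⟨κ × ι, inferInstance, fun q => p' q.1 * p q.2, fun q => r' q.1 * r q.2,
      fun q => r' q.1 * b q.2 + b' q.1, fun q => mul_pos (h1 _) (hp _), ?_, fun q => ?_,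
      fun S hS => ?_, fun x hx => ?_⟩
    · rw [Fintype.sum_prod_type]
      simp only [← Finset.mul_sum, hp1, mul_one, h2]
    · have hρ : 0 ≤ ρ := (hr q.2).1.le.trans (hr q.2).2
      exact ⟨mul_pos (h3 _).1 (hr _).1, by
        rw [pow_succ]
        exact mul_le_mul (h3 _).2 (hr _).2 (hr _).1.le (by positivity)⟩
    · rw [Fintype.sum_prod_type, h4 S hS]
      refine Finset.sum_congr rfl fun k _ => ?_
      rw [hμ _ ((continuous_simMap r' b' k).measurable hS), Finset.mul_sum]
      refine Finset.sum_congr rfl fun j _ => ?_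
      rw [hcomp, Set.preimage_comp, mul_assoc]
    · obtain ⟨k, y, hy, rfl⟩ := Set.mem_iUnion.1 (h5 hx)
      rw [hF] at hy
      obtain ⟨j, z, hz, rfl⟩ := Set.mem_iUnion.1 hy
      exact Set.mem_iUnion.2 ⟨(k, j), z, hz, by rw [hcomp]; rfl⟩

lemma preimage_simMap_closedBall {j : ι} (hr : 0 < r j) (z ε : ℝ) :
    simMap r b j ⁻¹' Metric.closedBall z ε = Metric.closedBall ((z - b j) / r j) (ε / r j) := by
  ext x
  simp only [Set.mem_preimage, Metric.mem_closedBall, Real.dist_eq, simMap]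
  rw [le_div_iff₀ hr, ← abs_of_pos hr, ← abs_mul, abs_of_pos hr]
  congr! 2
  field_simp
  ring

/-- A self-similar measure on a set with at least two points is Hölder regular. -/
lemma exists_holder [Fintype ι] (hr : ∀ j, 0 < r j ∧ r j < 1) (hF : IsSelfSimilarSet r b F)
    (hF' : ∀ x : ℝ, F ≠ {x}) (hμ : IsSelfSimilarMeasure r b μ) :
    ∃ C α : ℝ, 0 < C ∧ 0 < α ∧ ∀ z ε : ℝ, 0 < ε → μ.real (Metric.closedBall z ε) ≤ C * ε ^ α := by
  have hcompl := measure_compl_eq_zero hr hF hμ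
  obtain ⟨hprob, p, hp, hp1, hμe⟩ := hμ
  obtain ⟨ρ, hρ0, hρ1, hρ⟩ := exists_ratio_bound hr
  obtain ⟨x, hx⟩ := hF.1
  obtain ⟨y, hy, hxy⟩ : ∃ y ∈ F, y ≠ x := by
    by_contra! h
    exact hF' x (Set.eq_singleton_iff_unique_mem.2 ⟨hx, h⟩)
  obtain ⟨D, hD⟩ := Metric.isBounded_iff.1 hF.2.1.isBounded
  have hd : 0 < dist x y := dist_pos.2 hxy.symm
  have hD0 : 0 < D := hd.trans_le (hD hx hy)
  -- Pieces of level `N` have diameter below a quarter of `dist x y`, so a ball of radius at most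
  -- `dist x y / 4` cannot meet both the piece containing `x` and the one containing `y`.
  obtain ⟨N, hN⟩ := exists_pow_lt_of_lt_one (div_pos hd (mul_pos four_pos hD0)) hρ1
  rw [lt_div_iff₀ (by positivity)] at hN
  obtain ⟨κ, _, p', r', b', h1, h2, h3, h4, h5⟩ := exists_iterated_system hF.2.2
    (fun j => (hp j).1) hp1 (fun j => ⟨(hr j).1, hρ j⟩)
    (fun S hS => real_eq_sum (fun j => (hp j).1.le) hμe hS) N
  obtain ⟨k₁, x₁, hx₁, hxk⟩ := Set.mem_iUnion.1 (h5 hx)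
  obtain ⟨k₂, y₁, hy₁, hyk⟩ := Set.mem_iUnion.1 (h5 hy)
  have : Nonempty κ := ⟨k₁⟩
  obtain ⟨kp, hkp⟩ := Finite.exists_min p'
  obtain ⟨kr, hkr⟩ := Finite.exists_min r'
  have hpiece : ∀ k, ∀ s ∈ F, ∀ t ∈ F, dist (simMap r' b' k s) (simMap r' b' k t) ≤ ρ ^ N * D := by
    intro k s hs t ht
    have : dist (simMap r' b' k s) (simMap r' b' k t) = r' k * dist s t := by
      rw [Real.dist_eq, Real.dist_eq, simMap, simMap]
      nth_rw 3 [← abs_of_pos (h3 k).1]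
      rw [← abs_mul]
      congr 1; ring
    rw [this]
    exact mul_le_mul (h3 k).2 (hD hs ht) dist_nonneg (by positivity)
  have hmiss : ∀ z ε, ε ≤ dist x y / 4 →
      ∃ k, μ.real (simMap r' b' k ⁻¹' Metric.closedBall z ε) = 0 := by
    intro z ε hε
    by_contra! hcon
    have hmeet : ∀ k, ∃ s ∈ F, simMap r' b' k s ∈ Metric.closedBall z ε := by
      intro k
      by_contra! hk
      refine hcon k ?_
      have hsub : simMap r' b' k ⁻¹' Metric.closedBall z ε ⊆ Fᶜ := fun s hs hsF => hk s hsF hs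
      rw [measureReal_def, measure_mono_null hsub hcompl, ENNReal.toReal_zero]
    obtain ⟨s, hs, hsz⟩ := hmeet k₁
    obtain ⟨t, ht, htz⟩ := hmeet k₂
    have e1 := hpiece k₁ x₁ hx₁ s hs
    have e2 := hpiece k₂ y₁ hy₁ t ht
    rw [hxk] at e1
    rw [hyk] at e2
    rw [Metric.mem_closedBall] at hsz htz
    have t1 := dist_triangle x (simMap r' b' k₁ s) z
    have t2 := dist_triangle y (simMap r' b' k₂ t) z
    have t3 := dist_triangle_right x y z
    linarith
  -- Missing one piece loses at least the smallest weight, so `θ` is the factor per scale; the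
  -- maximum with `1 / 2` keeps it positive. Halving the smallest ratio below gives `q < 1` without
  -- excluding `N = 0`.
  set θ := max (1 - p' kp) (1 / 2) with hθ
  have hθ0 : 0 < θ := lt_max_of_lt_right (by norm_num)
  have hθ1 : θ < 1 := max_lt (by linarith [h1 kp]) (by norm_num)
  set q := r' kr / 2 with hq
  have hq0 : 0 < q := half_pos (h3 kr).1
  have hq1 : q < 1 := by
    have := (h3 kr).2.trans (pow_le_one₀ hρ0.le hρ1.le)
    linarith
  have hdecay : ∀ n z ε, ε ≤ dist x y / 4 * q ^ n → μ.real (Metric.closedBall z ε) ≤ θ ^ n := by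
    intro n
    induction n with
    | zero => intro z ε _; simp
    | succ n ih =>
      intro z ε hε
      obtain ⟨k₀, hk₀⟩ := hmiss z ε (hε.trans (mul_le_of_le_one_right (by positivity)
        (pow_le_one₀ hq0.le hq1.le)))
      have hterm : ∀ k, μ.real (simMap r' b' k ⁻¹' Metric.closedBall z ε) ≤ θ ^ n := by
        intro k
        rw [preimage_simMap_closedBall (h3 k).1]
        refine ih _ _ ?_
        rw [div_le_iff₀ (h3 k).1]
        refine hε.trans ?_
        rw [pow_succ, ← mul_assoc]
        have := hkr k
        have := (h3 kr).1
        gcongr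
        linarith
      classical
      rw [h4 _ Metric.isClosed_closedBall.measurableSet, ← Finset.add_sum_erase _ _
        (Finset.mem_univ k₀), hk₀, mul_zero, zero_add]
      calc ∑ k ∈ Finset.univ.erase k₀, p' k * μ.real (simMap r' b' k ⁻¹' Metric.closedBall z ε)
          ≤ ∑ k ∈ Finset.univ.erase k₀, p' k * θ ^ n :=
            Finset.sum_le_sum fun k _ => mul_le_mul_of_nonneg_left (hterm k) (h1 k).le
        _ = (1 - p' k₀) * θ ^ n := by
            rw [← Finset.sum_mul, ← h2, ← Finset.add_sum_erase _ _ (Finset.mem_univ k₀),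
              add_sub_cancel_left]
        _ ≤ θ * θ ^ n := by
            gcongr
            exact le_max_of_le_left (by linarith [hkp k₀])
        _ = θ ^ (n + 1) := by ring
  set α := Real.log θ / Real.log q with hα
  have hα0 : 0 < α := div_pos_of_neg_of_neg (Real.log_neg hθ0 hθ1) (Real.log_neg hq0 hq1)
  have hqα : q ^ α = θ := by
    rw [Real.rpow_def_of_pos hq0, hα, mul_div_cancel₀ _ (Real.log_neg hq0 hq1).ne,
      Real.exp_log hθ0]
  set d := dist x y / 4 with hd4
  have hd0 : 0 < d := by positivity
  -- `α` is chosen so that `q ^ α = θ`; the extra factor `θ⁻¹` pays for rounding `ε / d` to a power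
  -- of `q`.
  refine ⟨(θ * d ^ α)⁻¹, α, by positivity, hα0, fun z ε hε => ?_⟩
  have hCε : (θ * d ^ α)⁻¹ * ε ^ α = θ⁻¹ * (ε / d) ^ α := by
    rw [Real.div_rpow hε.le hd0.le]
    field_simp
  rw [hCε]
  rcases le_or_gt ε d with hεd | hεd
  · obtain ⟨n, hn1, hn2⟩ := exists_nat_pow_near_of_lt_one (div_pos hε hd0)
      ((div_le_one hd0).2 hεd) hq0 hq1
    refine (hdecay n z ε ?_).trans ?_
    · rw [div_le_iff₀ hd0] at hn2
      linarith
    · have : θ ^ (n + 1) ≤ (ε / d) ^ α := by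
        calc θ ^ (n + 1) = (q ^ (n + 1)) ^ α := by
              rw [← hqα, ← Real.rpow_natCast, ← Real.rpow_natCast, ← Real.rpow_mul hq0.le,
                ← Real.rpow_mul hq0.le, mul_comm]
          _ ≤ _ := Real.rpow_le_rpow (by positivity) hn1.le hα0.le
      rw [pow_succ] at this
      rw [← div_eq_inv_mul, le_div_iff₀ hθ0]
      exact this
  · refine measureReal_le_one.trans ?_
    have h6 : 1 ≤ (ε / d) ^ α := Real.one_le_rpow ((one_le_div hd0).2 hεd.le) hα0.le
    have h7 : 1 ≤ θ⁻¹ := (one_le_inv₀ hθ0).2 hθ1.le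
    nlinarith

end Measure

/-! ### The Fourier transform: Lipschitz bound, self-similarity and mean-square decay. -/

section Fourier

variable {μ : Measure ℝ}

lemma exp_eq (ξ x : ℝ) : Complex.exp (-2 * Real.pi * Complex.I * ξ * x) =
    Complex.exp (((-2 * Real.pi * ξ * x : ℝ) : ℂ) * Complex.I) := by
  congr 1; push_cast; ring

lemma norm_exp_eq_one (ξ x : ℝ) : ‖Complex.exp (-2 * Real.pi * Complex.I * ξ * x)‖ = 1 := by
  rw [exp_eq, Complex.norm_exp_ofReal_mul_I]

lemma continuous_fourier_kernel (ξ : ℝ) :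
    Continuous fun x : ℝ => Complex.exp (-2 * Real.pi * Complex.I * ξ * x) := by fun_prop

lemma integrable_fourier_kernel [IsFiniteMeasure μ] (ξ : ℝ) :
    Integrable (fun x : ℝ => Complex.exp (-2 * Real.pi * Complex.I * ξ * x)) μ :=
  Integrable.of_bound (continuous_fourier_kernel ξ).aestronglyMeasurable 1
    (Filter.Eventually.of_forall fun x => (norm_exp_eq_one ξ x).le)

lemma norm_fourierTransform_le_one [IsProbabilityMeasure μ] (ξ : ℝ) :
    ‖fourierTransform μ ξ‖ ≤ 1 := by
  refine (norm_integral_le_of_norm_le_const (C := 1)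
    (Filter.Eventually.of_forall fun x => (norm_exp_eq_one ξ x).le)).trans ?_
  simp

lemma norm_fourierTransform_neg (ξ : ℝ) :
    ‖fourierTransform μ (-ξ)‖ = ‖fourierTransform μ ξ‖ := by
  rw [← RCLike.norm_conj (fourierTransform μ ξ), fourierTransform, fourierTransform,
    ← integral_conj]
  congr 2
  ext x
  rw [← Complex.exp_conj]
  congr 1
  simp [Complex.conj_ofNat]

lemma norm_fourierTransform_abs (ξ : ℝ) :
    ‖fourierTransform μ |ξ|‖ = ‖fourierTransform μ ξ‖ := by
  rcases abs_choice ξ with h | h <;> rw [h]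
  exact norm_fourierTransform_neg ξ

lemma norm_fourierTransform_sub_le [IsProbabilityMeasure μ] {D : ℝ} (hD : ∀ᵐ x ∂μ, |x| ≤ D)
    (ξ η : ℝ) :
    ‖fourierTransform μ ξ - fourierTransform μ η‖ ≤ 2 * Real.pi * D * |ξ - η| := by
  rw [fourierTransform, fourierTransform, ← integral_sub (integrable_fourier_kernel ξ)
    (integrable_fourier_kernel η)]
  refine (norm_integral_le_of_norm_le_const (C := 2 * Real.pi * D * |ξ - η|) ?_).trans (by simp)
  filter_upwards [hD] with x hx
  have e : Complex.exp (-2 * Real.pi * Complex.I * ξ * x)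
      - Complex.exp (-2 * Real.pi * Complex.I * η * x)
      = Complex.exp (-2 * Real.pi * Complex.I * η * x)
        * (Complex.exp (Complex.I * ((-2 * Real.pi * (ξ - η) * x : ℝ) : ℂ)) - 1) := by
    rw [mul_sub, ← Complex.exp_add, mul_one]
    congr 2
    push_cast; ring
  rw [e, norm_mul, norm_exp_eq_one, one_mul]
  refine (Real.norm_exp_I_mul_ofReal_sub_one_le).trans ?_
  rw [Real.norm_eq_abs, abs_mul, abs_mul, abs_mul, abs_neg, abs_two, abs_of_pos Real.pi_pos]
  have : 0 ≤ 2 * Real.pi * |ξ - η| := by positivity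
  nlinarith [mul_le_mul_of_nonneg_left hx this]

lemma continuous_fourierTransform [IsProbabilityMeasure μ] {D : ℝ} (hD : ∀ᵐ x ∂μ, |x| ≤ D) :
    Continuous (fourierTransform μ) := by
  have : LipschitzWith (Real.toNNReal (2 * Real.pi * D)) (fourierTransform μ) :=
    LipschitzWith.of_dist_le' fun ξ η => by
      rw [dist_eq_norm, Real.dist_eq]
      exact norm_fourierTransform_sub_le hD ξ η
  exact this.continuous

lemma norm_fourierTransform_le_sum {ι : Type*} [Fintype ι] {r b p : ι → ℝ}
    [IsProbabilityMeasure μ] (hp : ∀ j, 0 ≤ p j)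
    (hμ : μ = ∑ j, ENNReal.ofReal (p j) • μ.map (simMap r b j)) (ξ : ℝ) :
    ‖fourierTransform μ ξ‖ ≤ ∑ j, p j * ‖fourierTransform μ (r j * ξ)‖ := by
  have hcont := continuous_fourier_kernel ξ
  have hmap : ∀ j, IsProbabilityMeasure (μ.map (simMap r b j)) := fun j =>
    Measure.isProbabilityMeasure_map (continuous_simMap r b j).aemeasurable
  have e : fourierTransform μ ξ = ∑ j, (p j : ℂ) *
      (Complex.exp (-2 * Real.pi * Complex.I * ξ * b j) * fourierTransform μ (r j * ξ)) := by
    conv_lhs => rw [fourierTransform, hμ]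
    rw [integral_finsetSum_measure fun j _ =>
      (integrable_fourier_kernel ξ).smul_measure ENNReal.ofReal_ne_top]
    refine Finset.sum_congr rfl fun j _ => ?_
    rw [integral_smul_measure, integral_map (continuous_simMap r b j).aemeasurable
      hcont.aestronglyMeasurable, ENNReal.toReal_ofReal (hp j), Complex.real_smul,
      fourierTransform, ← integral_const_mul, ← integral_const_mul, ← integral_const_mul]
    refine integral_congr_ae (Filter.Eventually.of_forall fun x => ?_)
    simp only [simMap]
    congr 1
    rw [← Complex.exp_add]
    congr 1
    push_cast; ring
  rw [e]
  refine (norm_sum_le _ _).trans (Finset.sum_le_sum fun j _ => ?_)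
  rw [norm_mul, norm_mul, norm_exp_eq_one, one_mul, Complex.norm_real, Real.norm_eq_abs,
    abs_of_nonneg (hp j)]

/-- Convexity of the square. Passing to the square keeps subharmonicity and makes the averages
computable as double integrals. -/
lemma sq_norm_fourierTransform_le_sum {ι : Type*} [Fintype ι] {r b p : ι → ℝ}
    [IsProbabilityMeasure μ] (hp : ∀ j, 0 ≤ p j) (hp1 : ∑ j, p j = 1)
    (hμ : μ = ∑ j, ENNReal.ofReal (p j) • μ.map (simMap r b j)) (ξ : ℝ) :
    ‖fourierTransform μ ξ‖ ^ 2 ≤ ∑ j, p j * ‖fourierTransform μ (r j * ξ)‖ ^ 2 := by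
  refine (pow_le_pow_left₀ (norm_nonneg _) (norm_fourierTransform_le_sum hp hμ ξ) 2).trans ?_
  exact Real.pow_arith_mean_le_arith_mean_pow _ _ _ (fun j _ => hp j) hp1
    (fun j _ => norm_nonneg _) 2

/-- The squared modulus of the Fourier transform as a double integral. -/
lemma sq_norm_fourierTransform [IsProbabilityMeasure μ] (ξ : ℝ) :
    ‖fourierTransform μ ξ‖ ^ 2 =
      ∫ z : ℝ × ℝ, Real.cos (2 * Real.pi * (z.1 - z.2) * ξ) ∂(μ.prod μ) := by
  set c : ℝ → ℝ := fun x => Real.cos (2 * Real.pi * x * ξ)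
  set s : ℝ → ℝ := fun x => Real.sin (2 * Real.pi * x * ξ)
  have hc : Integrable c μ := Integrable.of_bound (by fun_prop) 1
    (Filter.Eventually.of_forall fun x => Real.abs_cos_le_one _)
  have hs : Integrable s μ := Integrable.of_bound (by fun_prop) 1
    (Filter.Eventually.of_forall fun x => Real.abs_sin_le_one _)
  have hft : fourierTransform μ ξ =
      ((∫ x, c x ∂μ : ℝ) : ℂ) - ((∫ x, s x ∂μ : ℝ) : ℂ) * Complex.I := by
    rw [← integral_complex_ofReal, ← integral_complex_ofReal, ← integral_mul_const,
      ← integral_sub hc.ofReal (hs.ofReal.mul_const _), fourierTransform]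
    congr 1
    ext x
    rw [exp_eq, Complex.exp_mul_I, ← Complex.ofReal_cos, ← Complex.ofReal_sin,
      show -2 * Real.pi * ξ * x = -(2 * Real.pi * x * ξ) by ring, Real.cos_neg, Real.sin_neg]
    simp only [c, s]
    push_cast
    ring
  have hnorm : ‖fourierTransform μ ξ‖ ^ 2 = (∫ x, c x ∂μ) * (∫ x, c x ∂μ)
      + (∫ x, s x ∂μ) * (∫ x, s x ∂μ) := by
    rw [hft, Complex.sq_norm, Complex.normSq_apply]
    simp
  rw [hnorm, ← integral_prod_mul, ← integral_prod_mul,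
    ← integral_add (hc.mul_prod hc) (hs.mul_prod hs)]
  congr 1
  ext z
  simp only [c, s]
  rw [← Real.cos_sub]
  congr 1
  ring

/-- Trivial bound for small `t`, cancellation by explicit integration for `|t| > ε`. -/
lemma integral_cos_le {a b ε : ℝ} (hab : a ≤ b) (hε : 0 < ε) (t : ℝ) :
    ∫ ξ in a..b, Real.cos (2 * Real.pi * t * ξ) ≤
      (b - a) * (if |t| ≤ ε then 1 else 0) + 1 / ε := by
  split_ifs with h
  · have := intervalIntegral.integral_mono_on (μ := volume) hab
      (Continuous.intervalIntegrable (u := fun ξ => Real.cos (2 * Real.pi * t * ξ))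
        (by fun_prop) _ _)
      (intervalIntegrable_const (c := (1 : ℝ))) (fun ξ _ => Real.cos_le_one _)
    rw [intervalIntegral.integral_const, smul_eq_mul] at this
    have : 0 ≤ 1 / ε := by positivity
    linarith
  · push Not at h
    have ht : t ≠ 0 := by rintro rfl; simp at h; linarith
    have hpt : 2 * Real.pi * t ≠ 0 := by
      have := Real.pi_ne_zero
      positivity
    rw [intervalIntegral.integral_comp_mul_left (fun x => Real.cos x) hpt, integral_cos,
      smul_eq_mul, mul_zero, zero_add]
    refine (le_abs_self _).trans ?_
    rw [abs_mul, abs_inv, abs_mul, abs_mul, abs_two, abs_of_pos Real.pi_pos,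
      inv_mul_eq_div, div_le_div_iff₀ (by positivity) hε, one_mul]
    have h1 : |Real.sin (2 * Real.pi * t * b) - Real.sin (2 * Real.pi * t * a)| ≤ 2 := by
      refine (abs_sub _ _).trans ?_
      have := Real.abs_sin_le_one (2 * Real.pi * t * b)
      have := Real.abs_sin_le_one (2 * Real.pi * t * a)
      linarith
    have h2 : 2 * ε ≤ 2 * Real.pi * |t| := by
      have := Real.pi_gt_three
      nlinarith
    nlinarith

/-- By Fubini the frequency integral is taken first: only pairs within `ε` of the diagonal escape
cancellation, and they have `μ × μ`-mass at most `H`. -/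
lemma integral_sq_norm_fourierTransform_le [IsProbabilityMeasure μ] {H : ℝ} {a b ε : ℝ}
    (hab : a ≤ b) (hε : 0 < ε) (hH : ∀ z, μ.real (Metric.closedBall z ε) ≤ H) :
    ∫ ξ in a..b, ‖fourierTransform μ ξ‖ ^ 2 ≤ (b - a) * H + 1 / ε := by
  simp only [sq_norm_fourierTransform]
  have : IsFiniteMeasure (volume.restrict (Set.uIoc a b)) :=
    ⟨by simp [Set.uIoc_of_le hab]⟩
  have hcosint : Integrable (Function.uncurry fun (ξ : ℝ) (z : ℝ × ℝ) =>
      Real.cos (2 * Real.pi * (z.1 - z.2) * ξ))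
      ((volume.restrict (Set.uIoc a b)).prod (μ.prod μ)) := by
    refine Integrable.of_bound (Continuous.aestronglyMeasurable ?_) 1
      (Filter.Eventually.of_forall fun x => Real.abs_cos_le_one _)
    unfold Function.uncurry
    fun_prop
  rw [intervalIntegral_integral_swap hcosint]
  set S : Set (ℝ × ℝ) := {z | |z.1 - z.2| ≤ ε} with hS
  have hSm : MeasurableSet S := measurableSet_le (by fun_prop) measurable_const
  have hSH : (μ.prod μ).real S ≤ H := by
    have h0 : 0 ≤ H := measureReal_nonneg.trans (hH 0)
    rw [measureReal_def, Measure.prod_apply hSm]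
    refine ENNReal.toReal_le_of_le_ofReal h0 ?_
    calc ∫⁻ x, μ (Prod.mk x ⁻¹' S) ∂μ ≤ ∫⁻ _, ENNReal.ofReal H ∂μ := by
          refine lintegral_mono fun x => ?_
          have : Prod.mk x ⁻¹' S = Metric.closedBall x ε := by
            ext y
            simp [hS, Metric.mem_closedBall, Real.dist_eq, abs_sub_comm]
          rw [this, ← ofReal_measureReal]
          exact ENNReal.ofReal_le_ofReal (hH x)
      _ = ENNReal.ofReal H := by simp
  have hind : Integrable (S.indicator fun _ => (1 : ℝ)) (μ.prod μ) :=
    (integrable_const 1).indicator hSm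
  calc ∫ z : ℝ × ℝ, (∫ ξ in a..b, Real.cos (2 * Real.pi * (z.1 - z.2) * ξ)) ∂(μ.prod μ)
      ≤ ∫ z : ℝ × ℝ, ((b - a) * S.indicator (fun _ => (1 : ℝ)) z + 1 / ε) ∂(μ.prod μ) := by
        refine integral_mono ?_ ((hind.const_mul _).add (integrable_const _)) fun z => ?_
        · have h1 := hcosint.swap.integral_prod_left
          simp only [intervalIntegral.integral_of_le hab]
          rw [Set.uIoc_of_le hab] at h1
          exact h1
        · refine (integral_cos_le hab hε (z.1 - z.2)).trans (le_of_eq ?_)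
          simp only [Set.indicator_apply, hS, Set.mem_ofPred_eq]
    _ = (b - a) * (μ.prod μ).real S + 1 / ε := by
        rw [integral_add (hind.const_mul _) (integrable_const _), integral_const_mul,
          integral_indicator_const _ hSm]
        simp
    _ ≤ _ := by
        have : 0 ≤ b - a := by linarith
        gcongr

/-- Logarithmic averages of the squared Fourier transform of a Hölder regular measure decay
polynomially in the frequency. -/
lemma exists_average_decay [IsProbabilityMeasure μ] {D : ℝ} (hD : ∀ᵐ x ∂μ, |x| ≤ D) {C α : ℝ}
    (hC : 0 < C) (hα : 0 < α)
    (hH : ∀ z ε : ℝ, 0 < ε → μ.real (Metric.closedBall z ε) ≤ C * ε ^ α) {l : ℝ} (hl : 0 < l) :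
    ∃ C' γ : ℝ, 0 < C' ∧ 0 < γ ∧ ∀ y : ℝ,
      ∫ z in (0 : ℝ)..1, ‖fourierTransform μ (Real.exp (y - l * z))‖ ^ 2 ≤
        C' * Real.exp (-γ * y) := by
  have hcont : Continuous fun ξ => ‖fourierTransform μ ξ‖ ^ 2 :=
    (continuous_fourierTransform hD).norm.pow 2
  have hcont' (y : ℝ) : Continuous fun z => ‖fourierTransform μ (Real.exp (y - l * z))‖ ^ 2 :=
    hcont.comp (by fun_prop)
  refine ⟨Real.exp l * (C + 1) / l + 1, min α 1 / 2, by positivity, by positivity, fun y => ?_⟩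
  have hγ0 : 0 < min α 1 := by positivity
  rcases le_or_gt y 0 with hy | hy
  · have h1 := intervalIntegral.integral_mono_on (μ := volume) zero_le_one
      ((hcont' y).intervalIntegrable _ _) (intervalIntegrable_const (c := (1 : ℝ)))
      (fun z _ => pow_le_one₀ (norm_nonneg _) (norm_fourierTransform_le_one _))
    rw [intervalIntegral.integral_const, smul_eq_mul, sub_zero, one_mul] at h1
    have h2 : 1 ≤ Real.exp (-(min α 1 / 2) * y) := Real.one_le_exp (by nlinarith)
    have h3 : 0 ≤ Real.exp l * (C + 1) / l := by positivity
    nlinarith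
  have hsub : ∫ z in (0 : ℝ)..1, ‖fourierTransform μ (Real.exp (y - l * z))‖ ^ 2 *
      (l * Real.exp (y - l * z)) =
      ∫ ξ in Real.exp (y - l)..Real.exp y, ‖fourierTransform μ ξ‖ ^ 2 := by
    have h1 := intervalIntegral.integral_comp_mul_deriv (a := 0) (b := 1)
      (f := fun z => Real.exp (y - l * z)) (f' := fun z => Real.exp (y - l * z) * (-(l * 1)))
      (fun z _ => (((hasDerivAt_id z).const_mul l).const_sub y).exp) (by fun_prop) hcont
    rw [mul_one, mul_zero, sub_zero] at h1
    rw [intervalIntegral.integral_symm (Real.exp y), ← h1, ← intervalIntegral.integral_neg]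
    refine intervalIntegral.integral_congr fun z _ => ?_
    simp only [Function.comp]
    ring
  -- The Jacobian `l * exp (y - l z)` of the substitution `ξ = exp (y - l z)` is at least `l * exp
  -- (y - l)` on `[0, 1]`.
  have hle : l * Real.exp (y - l) *
      ∫ z in (0 : ℝ)..1, ‖fourierTransform μ (Real.exp (y - l * z))‖ ^ 2 ≤
      ∫ ξ in Real.exp (y - l)..Real.exp y, ‖fourierTransform μ ξ‖ ^ 2 := by
    rw [← hsub, ← intervalIntegral.integral_const_mul]
    refine intervalIntegral.integral_mono_on (μ := volume) zero_le_one
      (((hcont' y).const_mul _).intervalIntegrable _ _)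
      (Continuous.intervalIntegrable ((hcont' y).mul (by fun_prop)) _ _) fun z hz => ?_
    rw [mul_comm]
    gcongr
    nlinarith [hz.2]
  -- With `ε = exp (-y / 2)` the two error terms, relative to `exp y`, are of order `exp (-α y / 2)`
  -- and `exp (-y / 2)`, whence the exponent `min α 1 / 2`.
  have hbd := integral_sq_norm_fourierTransform_le (μ := μ) (a := Real.exp (y - l))
    (b := Real.exp y) (Real.exp_le_exp.2 (by linarith)) (Real.exp_pos (-(y / 2)))
    (fun z => hH z _ (Real.exp_pos _))
  have hεα : Real.exp (-(y / 2)) ^ α ≤ Real.exp (-(min α 1 / 2) * y) := by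
    rw [← Real.exp_mul]
    refine Real.exp_le_exp.2 ?_
    have := min_le_left α 1
    nlinarith
  have hε1 : 1 / Real.exp (-(y / 2)) ≤ Real.exp y * Real.exp (-(min α 1 / 2) * y) := by
    rw [one_div, ← Real.exp_neg, ← Real.exp_add]
    refine Real.exp_le_exp.2 ?_
    have := min_le_right α 1
    nlinarith
  have hXY : Real.exp y = Real.exp l * Real.exp (y - l) := by rw [← Real.exp_add]; congr 1; ring
  set E := Real.exp (-(min α 1 / 2) * y) with hE
  have hE0 : 0 < E := Real.exp_pos _
  set X := Real.exp (y - l) with hX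
  have hX0 : 0 < X := Real.exp_pos _
  set J := ∫ z in (0 : ℝ)..1, ‖fourierTransform μ (Real.exp (y - l * z))‖ ^ 2
  have h1 : (Real.exp y - X) * (C * Real.exp (-(y / 2)) ^ α) ≤ Real.exp y * (C * E) := by
    have : 0 ≤ C * Real.exp (-(y / 2)) ^ α := by positivity
    gcongr
    linarith
  have h2 : l * X * J ≤ l * X * (Real.exp l * (C + 1) / l * E) := by
    have : l * X * (Real.exp l * (C + 1) / l * E) = Real.exp y * (C * E) + Real.exp y * E := by
      rw [hXY]; field_simp
    linarith
  have h3 := le_of_mul_le_mul_left h2 (by positivity)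
  linarith

end Fourier

/-! ### From average decay to pointwise decay. -/

section Decay

variable {ι : Type*} [Fintype ι] {p l : ι → ℝ}

lemma abs_exp_sub_exp_le {s t B : ℝ} (hs : s ≤ B) (ht : t ≤ B) :
    |Real.exp s - Real.exp t| ≤ Real.exp B * |s - t| := by
  have key : ∀ s t : ℝ, s ≤ B → Real.exp s - Real.exp t ≤ Real.exp B * |s - t| := by
    intro s t hs
    have h1 : Real.exp t = Real.exp s * Real.exp (t - s) := by rw [← Real.exp_add]; congr 1; ring
    have h2 := Real.add_one_le_exp (t - s)
    have h3 : Real.exp s - Real.exp t ≤ Real.exp s * (s - t) := by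
      rw [h1]; nlinarith [Real.exp_pos s]
    have h4 : Real.exp s * |s - t| ≤ Real.exp B * |s - t| := by gcongr
    have h5 : Real.exp s * (s - t) ≤ Real.exp s * |s - t| := by gcongr; exact le_abs_self _
    linarith
  rw [abs_le]
  constructor
  · have := key t s ht
    rw [abs_sub_comm] at this
    linarith
  · exact key s t hs

/-- Quantitative smallness of a subharmonic function whose local averages decay exponentially. -/
lemma exists_subharmonic_bound (hp : ∀ k, 0 < p k) (hp1 : ∑ k, p k = 1) (hl : ∀ k, 0 < l k)
    {u : ℝ → ℝ} (hu0 : ∀ s, 0 ≤ u s) (hu1 : ∀ s, u s ≤ 1)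
    (hsub : ∀ s, u s ≤ ∑ k, p k * u (s - l k)) (hcont : Continuous u) {L : ℝ} (hL : 0 ≤ L)
    (hLip : ∀ s t, |u s - u t| ≤ L * |Real.exp s - Real.exp t|) {i j : ι}
    (hdioph : IsDiophantine (l i / l j)) {C γ : ℝ} (hC : 0 < C) (hγ : 0 < γ)
    (hint : ∀ y, ∫ z in (0 : ℝ)..1, u (y - l j * z) ≤ C * Real.exp (-γ * y)) :
    ∃ c e K B : ℝ, 0 < c ∧ 1 < e ∧ 0 < K ∧ 0 < B ∧ ∀ Q n : ℕ, 0 < Q → 0 < n →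
      ∃ q : ℕ, 0 < q ∧ q ≤ Q ∧ c * Q ≤ (q : ℝ) ^ e ∧ ∀ A s : ℝ, A + B * (Q + n) ≤ s →
        u s ≤ K * (Real.exp (-γ * A) + Real.exp A / q + Q / √n) := by
  have : Nonempty ι := ⟨i⟩
  obtain ⟨klo, hlo⟩ := Finite.exists_min l
  obtain ⟨khi, hhi⟩ := Finite.exists_max l
  obtain ⟨kp, hkp⟩ := Finite.exists_min p
  set lo := l klo
  set hi := l khi
  have hlo0 : 0 < lo := hl klo
  have hhi0 : 0 < hi := hl khi
  set α := l i / l j with hα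
  have hα0 : 0 < α := div_pos (hl i) (hl j)
  obtain ⟨c, hc, e, he, happ⟩ := hdioph.exists_approx hα0
  -- The combinations lie within `l j / q` of points of `[0, l j]`, hence have modulus at most `2 *
  -- hi`.
  set w := 2 * hi with hw
  set K₁ := C * Real.exp (γ * (hi + w)) with hK₁
  set K₂ := L * (Real.exp (2 * w) * (2 * hi)) with hK₂
  set K₃ := (hi + 2 * w) / lo + 1 with hK₃
  set K₄ := (α + 2) * ((hi / lo + 1) / √(p kp)) with hK₄
  have hK₁0 : 0 < K₁ := by positivity
  have hK₂0 : 0 ≤ K₂ := by positivity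
  have hK₃0 : 0 < K₃ := by positivity
  have hK₄0 : 0 ≤ K₄ := by positivity
  refine ⟨c, e, (K₁ + K₂) * K₃ + K₄, (α + 4) * hi, hc, he, by positivity, by positivity,
    fun Q n hQ hn => ?_⟩
  obtain ⟨q, P, hq, hqQ, hPq, hαP, hcQ⟩ := happ Q hQ
  -- `q` is fixed before `A`, so that `A` may later depend on `q`.
  refine ⟨q, hq, hqQ, hcQ, fun A s hs => ?_⟩
  have hqR : (0 : ℝ) < q := by exact_mod_cast hq
  have hq1 : (1 : ℝ) ≤ q := by exact_mod_cast hq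
  have hQR : (1 : ℝ) ≤ Q := by exact_mod_cast hQ
  have hqQR : (q : ℝ) ≤ Q := by exact_mod_cast hqQ
  have hnR : (1 : ℝ) ≤ n := by exact_mod_cast hn
  set x : ℕ → ℝ := fun a => a * l i - (a * P / q : ℕ) * l j with hx
  have hnear : ∀ a < q, |x a - l j * (((a * P % q : ℕ) : ℝ) / q)| ≤ l j / q := fun a ha =>
    abs_combination_sub_le hq hqQ ha (hl j) hαP
  have hfrac : ∀ a, 0 ≤ l j * (((a * P % q : ℕ) : ℝ) / q) ∧
      l j * (((a * P % q : ℕ) : ℝ) / q) ≤ l j := by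
    intro a
    have h1 : ((a * P % q : ℕ) : ℝ) ≤ q := by exact_mod_cast (Nat.mod_lt _ hq).le
    have := (hl j).le
    exact ⟨by positivity, mul_le_of_le_one_right this ((div_le_one hqR).2 h1)⟩
  have hjq : l j / q ≤ l j := div_le_self (hl j).le hq1
  have hxw : ∀ a < q, |x a| ≤ w := by
    intro a ha
    have h1 := abs_le.1 (hnear a ha)
    have h2 := hfrac a
    have h3 := hhi j
    rw [abs_le]
    constructor <;> linarith
  have hPQ : (P : ℝ) ≤ (α + 1) * Q := by
    have h1 := (abs_le.1 hαP).1
    have h2 : (P : ℝ) / q ≤ α + 1 / (Q * q) := by linarith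
    rw [div_le_iff₀ hqR] at h2
    have h3 : (α + 1 / (Q * q)) * q = α * q + 1 / Q := by field_simp
    have h4 : 1 / (Q : ℝ) ≤ Q := ((div_le_one (by linarith)).2 hQR).trans hQR
    nlinarith
  have hT : ∀ a < q, ((a : ℝ) + (a * P / q : ℕ)) ≤ (α + 2) * Q := by
    intro a ha
    have h1 : (a : ℝ) ≤ q := by exact_mod_cast ha.le
    have h2 : ((a * P / q : ℕ) : ℝ) ≤ P := by
      exact_mod_cast Nat.div_le_of_le_mul (Nat.mul_le_mul_right P ha.le)
    linarith
  -- Riemann sum comparison: on each cell the arguments of `u` differ by at most `2 * hi / q` and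
  -- stay below `A + 2 * w`, so the Lipschitz bound costs `O(exp A / q)`.
  have hη : ∀ y, A - hi - w ≤ y → y < A + w → ∑ a ∈ Finset.range q, u (y - x a) ≤
      (Finset.range q).card * (K₁ * Real.exp (-γ * A) + K₂ * (Real.exp A / q)) := by
    intro y hy hy'
    rw [Finset.card_range]
    have h1 := sum_le_mul_integral hq hPq (v := fun z => u (y - l j * z))
      (v' := fun a => u (y - x a)) (K := K₂ * (Real.exp A / q)) (hcont.comp (by fun_prop))
      (fun a ha z hz hz' => by
        have hz1 : l j * (((a * P % q : ℕ) : ℝ) / q) ≤ l j * z :=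
          mul_le_mul_of_nonneg_left hz (hl j).le
        have hz2 : l j * z ≤ l j * (((a * P % q : ℕ) : ℝ) / q) + l j / q := by
          have := mul_le_mul_of_nonneg_left hz' (hl j).le
          rw [add_div] at this
          linarith [mul_one_div (l j) (q : ℝ), mul_add (l j) (((a * P % q : ℕ) : ℝ) / q) (1 / q)]
        have h2 := abs_le.1 (hnear a ha)
        have h3 := hfrac a
        have h4 := abs_le.1 (hxw a ha)
        have h5 : |(y - x a) - (y - l j * z)| ≤ 2 * hi / q := by
          have h6 : l j / q ≤ hi / q := by gcongr; exact hhi j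
          have h7 : 2 * hi / q = hi / q + hi / q := by ring
          rw [abs_le]
          constructor <;> linarith
        have h8 : |Real.exp (y - x a) - Real.exp (y - l j * z)| ≤
            Real.exp (A + 2 * w) * (2 * hi / q) :=
          (abs_exp_sub_exp_le (B := A + 2 * w) (by linarith) (by linarith)).trans (by gcongr)
        have h9 := (le_abs_self _).trans (hLip (y - x a) (y - l j * z))
        have h10 := mul_le_mul_of_nonneg_left h8 hL
        have h11 : L * (Real.exp (A + 2 * w) * (2 * hi / q)) = K₂ * (Real.exp A / q) := by
          rw [Real.exp_add, hK₂]; ring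
        linarith)
    refine h1.trans (mul_le_mul_of_nonneg_left (add_le_add_left ((hint y).trans ?_) _) hqR.le)
    rw [hK₁, mul_assoc, ← Real.exp_add]
    refine mul_le_mul_of_nonneg_left (Real.exp_le_exp.2 ?_) hC.le
    nlinarith
  have hmain := subharmonic_le hp hp1 hlo0 hlo hhi hu0 hu1 hsub i j (A := A) (s := s)
    (η := K₁ * Real.exp (-γ * A) + K₂ * (Real.exp A / q)) (w := w) (T := (α + 2) * Q) hn
    (t := Finset.range q) ⟨0, Finset.mem_range.2 hq⟩ (x := x) (a := id) (m := fun a => a * P / q)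
    (fun a _ => rfl) (fun a ha => hT a (Finset.mem_range.1 ha))
    (fun a ha => hxw a (Finset.mem_range.1 ha)) (by positivity) hη (hp kp) hkp (by
      have e1 : 0 ≤ α * n * hi := by positivity
      have e2 : hi ≤ Q * hi := le_mul_of_one_le_left hhi0.le hQR
      have e3 : hi ≤ n * hi := le_mul_of_one_le_left hhi0.le hnR
      linarith)
  have h1 : (α + 2) * Q * ((hi / lo + 1) / √(n * p kp)) = K₄ * (Q / √n) := by
    rw [Real.sqrt_mul (Nat.cast_nonneg n), hK₄]
    have := (Real.sqrt_pos.2 (hp kp)).ne'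
    field_simp
  rw [h1] at hmain
  refine hmain.trans ?_
  have e1 : 0 ≤ Real.exp (-γ * A) := (Real.exp_pos _).le
  have e2 : 0 ≤ Real.exp A / q := by positivity
  have e3 : 0 ≤ (Q : ℝ) / √n := by positivity
  have expand : ((K₁ + K₂) * K₃ + K₄) * (Real.exp (-γ * A) + Real.exp A / q + Q / √n) -
      ((K₁ * Real.exp (-γ * A) + K₂ * (Real.exp A / q)) * K₃ + K₄ * (Q / √n)) =
      K₂ * K₃ * Real.exp (-γ * A) + K₄ * Real.exp (-γ * A) + K₁ * K₃ * (Real.exp A / q)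
        + K₄ * (Real.exp A / q) + (K₁ + K₂) * K₃ * (Q / √n) := by ring
  have : 0 ≤ K₂ * K₃ * Real.exp (-γ * A) + K₄ * Real.exp (-γ * A) + K₁ * K₃ * (Real.exp A / q)
        + K₄ * (Real.exp A / q) + (K₁ + K₂) * K₃ * (Q / √n) := by positivity
  linarith

/-- Optimising the parameters in `exists_subharmonic_bound` gives polynomial decay. -/
lemma exists_rpow_decay {u : ℝ → ℝ} {c e K B γ : ℝ} (hc : 0 < c) (he : 1 < e) (hK : 0 < K)
    (hB : 0 < B) (hγ : 0 < γ)
    (h : ∀ Q n : ℕ, 0 < Q → 0 < n → ∃ q : ℕ, 0 < q ∧ q ≤ Q ∧ c * Q ≤ (q : ℝ) ^ e ∧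
      ∀ A s : ℝ, A + B * (Q + n) ≤ s →
        u s ≤ K * (Real.exp (-γ * A) + Real.exp A / q + Q / √n)) :
    ∃ β K' S : ℝ, 0 < β ∧ 0 < K' ∧ 0 < S ∧ ∀ s, S ≤ s → u s ≤ K' * s ^ (-β) := by
  have hγ1 : 0 < min γ 1 := by positivity
  set δ := min γ 1 / 2 with hδ
  have hδ0 : 0 < δ := by positivity
  have he0 : 0 < e := by linarith
  refine ⟨δ / e / 4, 3 * K * (c / 2) ^ (-(δ / e)), (2 * B + 2) ^ (4 : ℝ), by positivity,
    by positivity, by positivity, fun s hs => ?_⟩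
  have hs0 : 0 < s := lt_of_lt_of_le (by positivity) hs
  set R := s ^ (1 / 4 : ℝ) with hR
  have hR4 : R ^ 4 = s := by
    rw [hR, ← Real.rpow_natCast, ← Real.rpow_mul hs0.le]; norm_num
  have hRB : 2 * B + 2 ≤ R := by
    have := Real.rpow_le_rpow (by positivity) hs (by norm_num : (0 : ℝ) ≤ 1 / 4)
    rwa [← Real.rpow_mul (by positivity), show (4 : ℝ) * (1 / 4) = 1 by norm_num,
      Real.rpow_one] at this
  set Q := ⌊R⌋₊ with hQ
  have hQle : (Q : ℝ) ≤ R := Nat.floor_le (by linarith)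
  have hQlt : R < Q + 1 := Nat.lt_floor_add_one R
  have hQB : 2 * B + 1 ≤ (Q : ℝ) := by linarith
  have hQ1 : (1 : ℝ) ≤ Q := by linarith
  have hQpos : 0 < Q := by exact_mod_cast (by linarith : (0 : ℝ) < Q)
  -- With `n = Q ^ 3` and `A = log q / 2` the three errors are `q ^ (-γ / 2)`, `q ^ (-1 / 2)` and `Q
  -- ^ (-1 / 2)`, all at most `q ^ (-δ)`. The required height is at most `Q ^ 4 ≤ s`, thanks to `Q ≥
  -- 2 * B + 1`.
  obtain ⟨q, hq, hqQ, hcq, hbound⟩ := h Q (Q ^ 3) hQpos (by positivity)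
  have hqR : (0 : ℝ) < q := by exact_mod_cast hq
  have hq1 : (1 : ℝ) ≤ q := by exact_mod_cast hq
  have hqQR : (q : ℝ) ≤ Q := by exact_mod_cast hqQ
  have hlog : Real.log q / 2 + B * (Q + (Q ^ 3 : ℕ)) ≤ s := by
    have h1 : Real.log q ≤ Q := (Real.log_le_self hqR.le).trans hqQR
    have h2 : (Q : ℝ) ≤ Q ^ 3 := by nlinarith [sq_nonneg ((Q : ℝ) - 1)]
    have h3 : (Q : ℝ) ^ 4 ≤ s := by rw [← hR4]; gcongr
    have h4 : (2 * B + 1) * (Q : ℝ) ^ 3 ≤ Q * Q ^ 3 := by gcongr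
    have h5 : B * Q ≤ B * Q ^ 3 := by gcongr
    push_cast
    nlinarith
  have hu := hbound (Real.log q / 2) s hlog
  have t1 : Real.exp (-γ * (Real.log q / 2)) ≤ (q : ℝ) ^ (-δ) := by
    rw [Real.rpow_def_of_pos hqR]
    refine Real.exp_le_exp.2 ?_
    have := Real.log_nonneg hq1
    have := min_le_left γ 1
    rw [hδ]
    nlinarith
  have t2 : Real.exp (Real.log q / 2) / q ≤ (q : ℝ) ^ (-δ) := by
    rw [Real.rpow_def_of_pos hqR]
    nth_rewrite 2 [← Real.exp_log hqR]
    rw [← Real.exp_sub]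
    refine Real.exp_le_exp.2 ?_
    have := Real.log_nonneg hq1
    have := min_le_right γ 1
    rw [hδ]
    nlinarith
  have t3 : (Q : ℝ) / √((Q ^ 3 : ℕ) : ℝ) ≤ (q : ℝ) ^ (-δ) := by
    have hQ0 : (0 : ℝ) < Q := by linarith
    have e1 : (Q : ℝ) / √((Q ^ 3 : ℕ) : ℝ) = (Q : ℝ) ^ (-(1 / 2) : ℝ) := by
      rw [Real.sqrt_eq_rpow, Nat.cast_pow, ← Real.rpow_natCast, ← Real.rpow_mul hQ0.le]
      nth_rewrite 1 [← Real.rpow_one (Q : ℝ)]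
      rw [← Real.rpow_sub hQ0]
      norm_num
    rw [e1]
    calc (Q : ℝ) ^ (-(1 / 2) : ℝ) ≤ (q : ℝ) ^ (-(1 / 2) : ℝ) :=
          Real.rpow_le_rpow_of_nonpos hqR hqQR (by norm_num)
      _ ≤ (q : ℝ) ^ (-δ) := by
          refine Real.rpow_le_rpow_of_exponent_le hq1 ?_
          have := min_le_right γ 1
          rw [hδ]; linarith
  -- Here `q ^ e ≥ c Q ≥ (c / 2) R` with `R = s ^ (1 / 4)`, since rounding down at most halves `R`.
  have hqs : (q : ℝ) ^ (-δ) ≤ (c / 2) ^ (-(δ / e)) * s ^ (-(δ / e / 4)) := by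
    have e1 : (q : ℝ) ^ (-δ) = ((q : ℝ) ^ e) ^ (-(δ / e)) := by
      rw [← Real.rpow_mul hqR.le]; congr 1; field_simp
    have e2 : s ^ (-(δ / e / 4)) = R ^ (-(δ / e)) := by
      rw [hR, ← Real.rpow_mul hs0.le]; congr 1; ring
    have hR0 : 0 < R := by linarith
    rw [e1, e2, ← Real.mul_rpow (by positivity) hR0.le]
    refine Real.rpow_le_rpow_of_nonpos (by positivity) ?_ (by
      have : 0 < δ / e := by positivity
      linarith)
    nlinarith
  calc u s ≤ K * (3 * (q : ℝ) ^ (-δ)) := hu.trans (by gcongr; linarith)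
    _ ≤ K * (3 * ((c / 2) ^ (-(δ / e)) * s ^ (-(δ / e / 4)))) := by gcongr
    _ = _ := by ring

end Decay

end SelfSimilar

/-! ### The theorem: the walk applied to the squared transform at logarithmic frequency. -/

theorem theorem1p3 {ι : Type*} [Fintype ι] (r b : ι → ℝ) (hr : ∀ j, 0 < r j ∧ r j < 1)
    (F : Set ℝ) (hF : SelfSimilar.IsSelfSimilarSet r b F) (hF_not_singleton : ∀ x : ℝ, F ≠ {x})
    (hdioph : ∃ i j : ι, i ≠ j ∧
      SelfSimilar.IsDiophantine (Real.log (r i) / Real.log (r j)))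
    (μ : MeasureTheory.Measure ℝ) (hμ : SelfSimilar.IsSelfSimilarMeasure r b μ) :
    ∃ β : ℝ, 0 < β ∧
      Asymptotics.IsBigO (Filter.comap (fun ξ : ℝ => |ξ|) Filter.atTop)
        (fun ξ : ℝ => ‖SelfSimilar.fourierTransform μ ξ‖)
        (fun ξ : ℝ => 1 / |Real.log (|ξ|)| ^ β) := by
  open SelfSimilar in
  obtain ⟨i, j, -, hij⟩ := hdioph
  have hcompl := measure_compl_eq_zero hr hF hμ
  obtain ⟨C, α, hC, hα, hH⟩ := exists_holder hr hF hF_not_singleton hμ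
  obtain ⟨hprob, p, hp, hp1, hμe⟩ := hμ
  obtain ⟨D, hD⟩ := hF.2.1.isBounded.exists_norm_le
  have hDae : ∀ᵐ x ∂μ, |x| ≤ D := by
    have : ∀ᵐ x ∂μ, x ∈ F := hcompl
    filter_upwards [this] with x hx using hD x hx
  have hD0 : 0 ≤ D := by
    obtain ⟨x, hx⟩ := hF.1
    exact (norm_nonneg x).trans (hD x hx)
  set l : ι → ℝ := fun k => -Real.log (r k) with hl_def
  have hl : ∀ k, 0 < l k := fun k => neg_pos.2 (Real.log_neg (hr k).1 (hr k).2)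
  have hij' : IsDiophantine (l i / l j) := by rwa [hl_def, neg_div_neg_eq]
  obtain ⟨C', γ, hC', hγ, hint⟩ := exists_average_decay hDae hC hα hH (hl j)
  set u : ℝ → ℝ := fun s => ‖fourierTransform μ (Real.exp s)‖ ^ 2 with hu
  have hsub : ∀ s, u s ≤ ∑ k, p k * u (s - l k) := by
    intro s
    refine (sq_norm_fourierTransform_le_sum (fun k => (hp k).1.le) hp1 hμe _).trans (le_of_eq ?_)
    refine Finset.sum_congr rfl fun k _ => ?_
    simp only [hu, hl_def]
    rw [sub_neg_eq_add, Real.exp_add, Real.exp_log (hr k).1, mul_comm (Real.exp s)]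
  have hLip : ∀ s t, |u s - u t| ≤ 4 * Real.pi * D * |Real.exp s - Real.exp t| := by
    intro s t
    have h1 := norm_fourierTransform_sub_le hDae (Real.exp s) (Real.exp t)
    have h2 := (abs_norm_sub_norm_le _ _).trans h1
    have h3 := norm_fourierTransform_le_one (μ := μ) (Real.exp s)
    have h4 := norm_fourierTransform_le_one (μ := μ) (Real.exp t)
    simp only [hu]
    rw [sq_sub_sq, abs_mul, abs_of_nonneg (by positivity)]
    calc _ ≤ 2 * (2 * Real.pi * D * |Real.exp s - Real.exp t|) := by
          gcongr
          linarith
      _ = _ := by ring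
  obtain ⟨c, e, K, B, hc, he, hK, hB, hbound⟩ := exists_subharmonic_bound (fun k => (hp k).1) hp1 hl
    (u := u) (fun s => sq_nonneg _)
    (fun s => pow_le_one₀ (norm_nonneg _) (norm_fourierTransform_le_one _)) hsub
    (((continuous_fourierTransform hDae).norm.pow 2).comp Real.continuous_exp) (by positivity) hLip
    hij' hC' hγ hint
  obtain ⟨β, K', S, hβ, hK', hS, hdecay⟩ := exists_rpow_decay hc he hK hB hγ hbound
  -- The decay obtained is for the squared modulus, so exponent and constant are halved and
  -- square-rooted.
  refine ⟨β / 2, by positivity, Asymptotics.IsBigO.of_bound (√K') ?_⟩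
  filter_upwards [Filter.tendsto_comap.eventually (Filter.eventually_ge_atTop (Real.exp S))]
    with ξ hξ
  have hξ0 : 0 < |ξ| := (Real.exp_pos S).trans_le hξ
  have hlog : S ≤ Real.log |ξ| := (Real.le_log_iff_exp_le hξ0).2 hξ
  have hlog0 : 0 < Real.log |ξ| := hS.trans_le hlog
  have h1 := hdecay _ hlog
  simp only [hu] at h1
  rw [Real.exp_log hξ0, norm_fourierTransform_abs] at h1
  rw [norm_norm, abs_of_pos hlog0, Real.norm_of_nonneg (by positivity), one_div,
    ← Real.rpow_neg hlog0.le]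
  refine abs_le_of_sq_le_sq' ?_ (by positivity) |>.2
  rw [mul_pow, Real.sq_sqrt hK'.le, ← Real.rpow_mul_natCast hlog0.le,
    show -(β / 2) * ((2 : ℕ) : ℝ) = -β by push_cast; ring]
  exact h1
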